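/- Let $n\ge 1$ and let $\mathrm{C}^{n-1}Z=\operatorname{diag}(1,\dots,1,-1)$ be the multi-controlled-$Z$ gate on $n$ qubits (with $\mathrm{C}^{0}Z=Z$). A pure $m$-qubit stabilizer state is a unit vector $|s\rangle\in(\mathbb{C}^2)^{\otimes m}$ that is fixed by exactly $2^m$ elements of the $m$-qubit Pauli group $\{i^kP_1\otimes\cdots\otimes P_m : 0\le k\le 3,\ P_j\in\{I,X,Y,Z\}\}$. Let $\mathrm{STAB}_m$ be the convex hull of the projectors $|s\rangle\langle s|$ onto the pure $m$-qubit stabilizer states. For an $m$-qubit state $\rho$, the robustness of magic is $$\mathcal{R}(\rho)=\min\{2a+1 : \rho=(a+1)\sigma-a\tau,\ a\ge 0,\ \sigma,\tau\in\mathrm{STAB}_m\},$$ and $\mathcal{R}(|\psi\rangle):=\mathcal{R}(|\psi\rangle\langle\psi|)$. The magic capacity of an $n$-qubit unitary $U$ is $$\mathcal{C}(U)=\max_{|s\rangle}\mathcal{R}\big((U\otimes\mathbb{I}_{2^n})|s\rangle\big),$$ where the maximum is over all pure $2n$-qubit stabilizer states $|s\rangle$. Then, for every $n\ge 1$, $$\mathcal{C}\left(\mathrm{C}^{n-1}Z\right)<5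 .$$ -/

import Mathlib

open scoped Matrix Kronecker ENNReal

noncomputable section

/-- Labels of the computational basis of a register whose qubits are indexed by `ι`. -/
abbrev Bits (ι : Type) : Type := ι → Fin 2

/-- The single-qubit Pauli matrices `I`, `X`, `Y`, `Z`, numbered `0`, `1`, `2`, `3`. -/
def pauli : Fin 4 → Matrix (Fin 2) (Fin 2) ℂ
  | 0 => !![1, 0; 0, 1]
  | 1 => !![0, 1; 1, 0]
  | 2 => !![0, -Complex.I; Complex.I, 0]
  | 3 => !![1, 0; 0, -1]

/-- The tensor product of the single-qubit Pauli matrices `pauli (P j)`, where `j` runs over the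
qubits. -/
def pauliString {ι : Type} [Fintype ι] (P : ι → Fin 4) : Matrix (Bits ι) (Bits ι) ℂ :=
  Matrix.of fun x y => ∏ j, pauli (P j) (x j) (y j)

/-- The Pauli group: the Pauli strings with phases `1`, `i`, `-1`, `-i`. -/
def pauliGroup (ι : Type) [Fintype ι] : Set (Matrix (Bits ι) (Bits ι) ℂ) :=
  {M | ∃ (k : Fin 4) (P : ι → Fin 4), M = Complex.I ^ (k : ℕ) • pauliString P}

/-- A pure stabilizer state of the qubits `ι`: a unit vector that is fixed by exactly `2 ^ |ι|`
elements of the Pauli group (the largest possible number). -/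
def IsPureStabilizer {ι : Type} [Fintype ι] [DecidableEq ι] (s : Bits ι → ℂ) : Prop :=
  ∑ x, ‖s x‖ ^ 2 = 1 ∧
    {M | M ∈ pauliGroup ι ∧ M *ᵥ s = s}.ncard = 2 ^ Fintype.card ι

/-- The operator `|ψ⟩⟨ψ|`. -/
def ketbra {ι : Type} (ψ : Bits ι → ℂ) : Matrix (Bits ι) (Bits ι) ℂ :=
  Matrix.vecMulVec ψ (star ψ)

/-- The (mixed) stabilizer states: the convex hull of all pure stabilizer states. -/
def STAB (ι : Type) [Fintype ι] [DecidableEq ι] : Set (Matrix (Bits ι) (Bits ι) ℂ) :=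
  convexHull ℝ {ρ | ∃ s : Bits ι → ℂ, IsPureStabilizer s ∧ ρ = ketbra s}

/-- The robustness of magic of `ρ`: the least value of `2 a + 1` over all decompositions
`ρ = (a + 1) σ - a τ` with `a ≥ 0` and stabilizer states `σ`, `τ`. It takes values in `[0, ∞]`, so
that it would be `∞` if there were no such decomposition. -/
def robustness {ι : Type} [Fintype ι] [DecidableEq ι] (ρ : Matrix (Bits ι) (Bits ι) ℂ) : ℝ≥0∞ :=
  sInf {r | ∃ (a : ℝ) (σ τ : Matrix (Bits ι) (Bits ι) ℂ), 0 ≤ a ∧ σ ∈ STAB ι ∧ τ ∈ STAB ι ∧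
    ρ = (a + 1) • σ - a • τ ∧ r = ENNReal.ofReal (2 * a + 1)}

/-- The operator `U ⊗ 𝟙` on two registers of the same size, where `U` acts on the first one. -/
def withAncilla {ι : Type} [Fintype ι] [DecidableEq ι] (U : Matrix (Bits ι) (Bits ι) ℂ) :
    Matrix (Bits (ι ⊕ ι)) (Bits (ι ⊕ ι)) ℂ :=
  (U ⊗ₖ (1 : Matrix (Bits ι) (Bits ι) ℂ)).submatrix
    (Equiv.sumArrowEquivProdArrow ι ι (Fin 2)) (Equiv.sumArrowEquivProdArrow ι ι (Fin 2))

/-- The magic capacity of a unitary `U` on the qubits `ι`: the largest robustness of magic of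
`(U ⊗ 𝟙)|s⟩` over all pure stabilizer states `|s⟩` of two copies of the register. -/
def magicCapacity {ι : Type} [Fintype ι] [DecidableEq ι] (U : Matrix (Bits ι) (Bits ι) ℂ) :
    ℝ≥0∞ :=
  sSup {r | ∃ s : Bits (ι ⊕ ι) → ℂ, IsPureStabilizer s ∧
    r = robustness (ketbra (withAncilla U *ᵥ s))}

/-- The gate `Cⁿ⁻¹Z = diag(1, …, 1, -1)` on `n` qubits: the basis state labelled by `1, …, 1` gets
the sign `-1`. -/
def multiControlledZ (n : ℕ) : Matrix (Bits (Fin n)) (Bits (Fin n)) ℂ :=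
  Matrix.diagonal fun x => if ∀ j, x j = 1 then -1 else 1

end

/-! The gate is a reflection: it flips the sign of one basis state `e` of the first register. Split
a stabilizer state as `s = ∑ u x + v`, where `v` is the part with first register `e` and the `u x`
are the other nonzero parts, `K` in number. The reflected state is `∑ u x - v`. Only the cross terms
with `v` change sign, and they are linear in `∑ u x`, so (`ketbra_sum_sub`) its projector equals
that of `s` plus the sum over `x` of `ketbra (u x - v) - ketbra (u x + v)`.

Each `u x ± v` is a multiple of a stabilizer state, and all parts have the same squared norm `q = 1
/ (K + 1)` (`IsStabilizerVector.component_pair`). After normalization this is a decomposition with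
`a = 2 * q * K`, so the robustness is at most `1 + 4 * K / (K + 1) = 5 - 4 / (K + 1)`. Since `K + 1`
is at most the dimension of the register, the bound is uniform in `s` and the supremum stays
strictly below 5.

The stabilizer input is that Pauli measurements preserve stabilizer states
(`IsStabilizerVector.measure`): keeping two values of the first register amounts to measuring
operators `±Z_i` and `±Z_i Z_j`. -/

/-! ### Multiplication, commutation and traces in the Pauli group. -/

section PauliAlgebra

variable {κ : Type} [Fintype κ]

/-- The tensor product of single-qubit operators. -/
def qubitTensor (A : κ → Matrix (Fin 2) (Fin 2) ℂ) : Matrix (Bits κ) (Bits κ) ℂ :=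
  Matrix.of fun x y => ∏ j, A j (x j) (y j)

theorem pauliString_eq_qubitTensor (P : κ → Fin 4) :
    pauliString P = qubitTensor fun j => pauli (P j) := rfl

theorem qubitTensor_mul [DecidableEq κ] (A B : κ → Matrix (Fin 2) (Fin 2) ℂ) :
    qubitTensor A * qubitTensor B = qubitTensor fun j => A j * B j := by
  ext x y
  simp only [qubitTensor, Matrix.mul_apply, Matrix.of_apply, Finset.prod_univ_sum,
    Fintype.piFinset_univ, Finset.prod_mul_distrib]

theorem qubitTensor_smul (c : κ → ℂ) (A : κ → Matrix (Fin 2) (Fin 2) ℂ) :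
    (qubitTensor fun j => c j • A j) = (∏ j, c j) • qubitTensor A := by
  ext x y
  simp [qubitTensor, Finset.prod_mul_distrib]

theorem qubitTensor_one [DecidableEq κ] :
    (qubitTensor fun _ : κ => (1 : Matrix (Fin 2) (Fin 2) ℂ)) = 1 := by
  ext x y
  simp [qubitTensor, Matrix.one_apply, Finset.prod_ite_zero, funext_iff]

theorem qubitTensor_trace [DecidableEq κ] (A : κ → Matrix (Fin 2) (Fin 2) ℂ) :
    (qubitTensor A).trace = ∏ j, (A j).trace := by
  simp only [qubitTensor, Matrix.trace, Matrix.diag_apply, Matrix.of_apply, Finset.prod_univ_sum,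
    Fintype.piFinset_univ]

theorem pauli_zero : pauli 0 = 1 := by
  ext i j; fin_cases i <;> fin_cases j <;> simp [pauli]

theorem pauli_mul_self (a : Fin 4) : pauli a * pauli a = 1 := by
  ext i j
  fin_cases a <;> fin_cases i <;> fin_cases j <;> simp [pauli, Matrix.mul_apply]

theorem pauli_trace {a : Fin 4} (ha : a ≠ 0) : (pauli a).trace = 0 := by
  fin_cases a <;> simp_all [pauli, Matrix.trace]

theorem pauli_star (a : Fin 4) (i j : Fin 2) : star (pauli a i j) = pauli a j i := by
  fin_cases a <;> fin_cases i <;> fin_cases j <;> simp [pauli]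

theorem exists_pauli_mul (a b : Fin 4) :
    ∃ (k : ℕ) (c : Fin 4), pauli a * pauli b = Complex.I ^ k • pauli c := by
  -- The Pauli multiplication table: first the exponents of `I`, then the resulting labels.
  refine ⟨(![![0, 0, 0, 0], ![0, 0, 1, 3], ![0, 3, 0, 1], ![0, 1, 3, 0]] :
      Fin 4 → Fin 4 → ℕ) a b,
    (![![0, 1, 2, 3], ![1, 0, 3, 2], ![2, 3, 0, 1], ![3, 2, 1, 0]] : Fin 4 → Fin 4 → Fin 4) a b,
    ?_⟩
  ext i j
  fin_cases a <;> fin_cases b <;> fin_cases i <;> fin_cases j <;>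
    simp [pauli, Matrix.mul_apply, Complex.I_pow_three]

theorem exists_pauli_comm (a b : Fin 4) :
    ∃ k : ℕ, pauli a * pauli b = (-1 : ℂ) ^ k • (pauli b * pauli a) := by
  refine ⟨if a = 0 ∨ b = 0 ∨ a = b then 0 else 1, ?_⟩
  ext i j
  fin_cases a <;> fin_cases b <;> fin_cases i <;> fin_cases j <;>
    simp [pauli, Matrix.mul_apply]

theorem I_pow_smul_pauliString_mem (k : ℕ) (P : κ → Fin 4) :
    Complex.I ^ k • pauliString P ∈ pauliGroup κ :=
  ⟨⟨k % 4, Nat.mod_lt _ (by norm_num)⟩, P, by rw [← Complex.I_pow_eq_pow_mod]⟩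

theorem pauliString_mem (P : κ → Fin 4) : pauliString P ∈ pauliGroup κ := by
  simpa using I_pow_smul_pauliString_mem 0 P

theorem I_pow_smul_mem {M : Matrix (Bits κ) (Bits κ) ℂ} (k : ℕ) (hM : M ∈ pauliGroup κ) :
    Complex.I ^ k • M ∈ pauliGroup κ := by
  obtain ⟨l, P, rfl⟩ := hM
  rw [smul_smul, ← pow_add]
  exact I_pow_smul_pauliString_mem _ _

theorem neg_mem_pauliGroup {M : Matrix (Bits κ) (Bits κ) ℂ} (hM : M ∈ pauliGroup κ) :
    -M ∈ pauliGroup κ := by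
  simpa using I_pow_smul_mem 2 hM

theorem pauliString_conjTranspose (P : κ → Fin 4) : (pauliString P)ᴴ = pauliString P := by
  ext x y
  simp only [pauliString, Matrix.conjTranspose_apply, Matrix.of_apply, star_prod, pauli_star]

theorem pauliGroup_finite : (pauliGroup κ).Finite := by
  refine (Set.finite_range fun q : Fin 4 × (κ → Fin 4) =>
    Complex.I ^ (q.1 : ℕ) • pauliString q.2).subset ?_
  rintro M ⟨k, P, rfl⟩
  exact ⟨(k, P), rfl⟩

variable [DecidableEq κ]

theorem one_mem_pauliGroup : (1 : Matrix (Bits κ) (Bits κ) ℂ) ∈ pauliGroup κ := by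
  have h := pauliString_mem (fun _ : κ => 0)
  rwa [pauliString_eq_qubitTensor, pauli_zero, qubitTensor_one] at h

theorem mul_mem_pauliGroup {M N : Matrix (Bits κ) (Bits κ) ℂ} (hM : M ∈ pauliGroup κ)
    (hN : N ∈ pauliGroup κ) : M * N ∈ pauliGroup κ := by
  obtain ⟨k, P, rfl⟩ := hM
  obtain ⟨l, Q, rfl⟩ := hN
  choose f g h using exists_pauli_mul
  rw [smul_mul_smul_comm, ← pow_add, pauliString_eq_qubitTensor, pauliString_eq_qubitTensor,
    qubitTensor_mul]
  simp only [h]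
  rw [qubitTensor_smul, Finset.prod_pow_eq_pow_sum]
  exact I_pow_smul_mem _ (I_pow_smul_mem _ (pauliString_mem _))

theorem pauliGroup_comm_or_anticomm {M N : Matrix (Bits κ) (Bits κ) ℂ} (hM : M ∈ pauliGroup κ)
    (hN : N ∈ pauliGroup κ) : M * N = N * M ∨ M * N = -(N * M) := by
  obtain ⟨k, P, rfl⟩ := hM
  obtain ⟨l, Q, rfl⟩ := hN
  choose f h using exists_pauli_comm
  have key : pauliString P * pauliString Q =
      (-1 : ℂ) ^ (∑ j, f (P j) (Q j)) • (pauliString Q * pauliString P) := by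
    simp only [pauliString_eq_qubitTensor, qubitTensor_mul]
    rw [← Finset.prod_pow_eq_pow_sum, ← qubitTensor_smul]
    exact congrArg _ (funext fun j => h _ _)
  rw [smul_mul_smul_comm, smul_mul_smul_comm, key, mul_comm (Complex.I ^ (l : ℕ))]
  rcases neg_one_pow_eq_or ℂ (∑ j, f (P j) (Q j)) with h1 | h1 <;> simp [h1]

theorem pauliString_mul_self (P : κ → Fin 4) : pauliString P * pauliString P = 1 := by
  simp only [pauliString_eq_qubitTensor, qubitTensor_mul, pauli_mul_self, qubitTensor_one]

theorem pauliString_trace {P : κ → Fin 4} (hP : P ≠ fun _ => 0) : (pauliString P).trace = 0 := by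
  obtain ⟨j, hj⟩ := Function.ne_iff.mp hP
  rw [pauliString_eq_qubitTensor, qubitTensor_trace]
  exact Finset.prod_eq_zero (Finset.mem_univ j) (pauli_trace hj)

theorem conjTranspose_mul_self_of_mem {M : Matrix (Bits κ) (Bits κ) ℂ} (hM : M ∈ pauliGroup κ) :
    Mᴴ * M = 1 := by
  obtain ⟨k, P, rfl⟩ := hM
  rw [Matrix.conjTranspose_smul, pauliString_conjTranspose, smul_mul_smul_comm,
    pauliString_mul_self, star_pow, ← mul_pow]
  simp

/-- A Pauli operator is Hermitian if it squares to one on a nonzero vector. -/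
theorem mul_self_and_isHermitian_of_fix {M : Matrix (Bits κ) (Bits κ) ℂ} (hM : M ∈ pauliGroup κ)
    {s : Bits κ → ℂ} (hs : s ≠ 0) (h : M *ᵥ s = s) : M * M = 1 ∧ Mᴴ = M := by
  have hsq : M * M = 1 := by
    obtain ⟨k, P, rfl⟩ := hM
    have h2 : (Complex.I ^ (k : ℕ) • pauliString P * Complex.I ^ (k : ℕ) • pauliString P) *ᵥ s
        = s := by rw [← Matrix.mulVec_mulVec, h, h]
    rw [smul_mul_smul_comm, pauliString_mul_self] at h2 ⊢
    rw [Matrix.smul_mulVec, Matrix.one_mulVec] at h2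
    obtain ⟨x, hx⟩ := Function.ne_iff.mp hs
    have h3 := congrFun h2 x
    simp only [Pi.smul_apply, smul_eq_mul] at h3
    rw [mul_left_eq_self₀.mp h3 |>.resolve_right hx, one_smul]
  refine ⟨hsq, ?_⟩
  calc Mᴴ = Mᴴ * (M * M) := by rw [hsq, mul_one]
    _ = M := by rw [← mul_assoc, conjTranspose_mul_self_of_mem hM, one_mul]

/-- A nontrivial string has a traceless tensor factor, and the only scalar that fixes a nonzero
vector is 1. -/
theorem trace_eq_zero_of_fix {M : Matrix (Bits κ) (Bits κ) ℂ} (hM : M ∈ pauliGroup κ)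
    {s : Bits κ → ℂ} (hs : s ≠ 0) (h : M *ᵥ s = s) (h1 : M ≠ 1) : M.trace = 0 := by
  obtain ⟨k, P, rfl⟩ := hM
  by_cases hP : P = fun _ => 0
  · subst hP
    have h0 : (pauliString fun _ : κ => 0) = 1 := by
      rw [pauliString_eq_qubitTensor, pauli_zero, qubitTensor_one]
    rw [h0] at h h1
    rw [Matrix.smul_mulVec, Matrix.one_mulVec] at h
    obtain ⟨x, hx⟩ := Function.ne_iff.mp hs
    have h3 := congrFun h x
    simp only [Pi.smul_apply, smul_eq_mul] at h3
    exact absurd (by rw [mul_left_eq_self₀.mp h3 |>.resolve_right hx, one_smul]) h1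
  · rw [Matrix.trace_smul, pauliString_trace hP, smul_zero]

end PauliAlgebra

/-! ### Stabilizer groups, their projectors, and Pauli measurements. -/

section StabilizerStates

variable {κ : Type} [Fintype κ] [DecidableEq κ]

/-- The elements of the Pauli group that fix `s`. -/
def fixingPaulis (s : Bits κ → ℂ) : Set (Matrix (Bits κ) (Bits κ) ℂ) :=
  {M | M ∈ pauliGroup κ ∧ M *ᵥ s = s}

theorem fixingPaulis_finite (s : Bits κ → ℂ) : (fixingPaulis s).Finite :=
  pauliGroup_finite.subset fun _ h => h.1

/-- The finite set of the elements of the Pauli group that fix `s`. -/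
noncomputable def fixingFinset (s : Bits κ → ℂ) : Finset (Matrix (Bits κ) (Bits κ) ℂ) :=
  (fixingPaulis_finite s).toFinset

theorem mem_fixingFinset {s : Bits κ → ℂ} {M : Matrix (Bits κ) (Bits κ) ℂ} :
    M ∈ fixingFinset s ↔ M ∈ pauliGroup κ ∧ M *ᵥ s = s := by
  simp [fixingFinset, fixingPaulis]

/-- A nonzero multiple of a pure stabilizer state. -/
def IsStabilizerVector (s : Bits κ → ℂ) : Prop :=
  s ≠ 0 ∧ (fixingFinset s).card = 2 ^ Fintype.card κ

open scoped ComplexOrder in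
theorem star_dotProduct_self_ne_zero {s : Bits κ → ℂ} (hs : s ≠ 0) : star s ⬝ᵥ s ≠ 0 := by
  rwa [Ne, dotProduct_star_self_eq_zero]

theorem norm_sq_eq_dotProduct (s : Bits κ → ℂ) :
    ((∑ x, ‖s x‖ ^ 2 : ℝ) : ℂ) = star s ⬝ᵥ s := by
  push_cast
  refine Finset.sum_congr rfl fun x _ => ?_
  rw [Pi.star_apply, RCLike.star_def, RCLike.conj_mul]
  rfl

theorem fixingFinset_smul {c : ℂ} (hc : c ≠ 0) (s : Bits κ → ℂ) :
    fixingFinset (c • s) = fixingFinset s := by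
  ext M
  rw [mem_fixingFinset, mem_fixingFinset, Matrix.mulVec_smul]
  exact and_congr_right fun _ => (smul_right_injective _ hc).eq_iff

theorem IsStabilizerVector.smul {c : ℂ} (hc : c ≠ 0) {s : Bits κ → ℂ}
    (hs : IsStabilizerVector s) : IsStabilizerVector (c • s) :=
  ⟨smul_ne_zero hc hs.1, by rw [fixingFinset_smul hc, hs.2]⟩

theorem isPureStabilizer_iff (s : Bits κ → ℂ) :
    IsPureStabilizer s ↔ ∑ x, ‖s x‖ ^ 2 = 1 ∧ IsStabilizerVector s := by
  have hcard : {M | M ∈ pauliGroup κ ∧ M *ᵥ s = s}.ncard = (fixingFinset s).card :=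
    Set.ncard_eq_toFinset_card _ (fixingPaulis_finite s)
  rw [IsPureStabilizer, IsStabilizerVector, hcard]
  refine and_congr_right fun h => ⟨fun h2 => ⟨?_, h2⟩, fun h2 => h2.2⟩
  rintro rfl
  simp at h

theorem mul_mem_fixingFinset {s : Bits κ → ℂ} {M N : Matrix (Bits κ) (Bits κ) ℂ}
    (hM : M ∈ fixingFinset s) (hN : N ∈ fixingFinset s) : M * N ∈ fixingFinset s := by
  rw [mem_fixingFinset] at *
  exact ⟨mul_mem_pauliGroup hM.1 hN.1, by rw [← Matrix.mulVec_mulVec, hN.2, hM.2]⟩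

theorem one_mem_fixingFinset (s : Bits κ → ℂ) : 1 ∈ fixingFinset s :=
  mem_fixingFinset.mpr ⟨one_mem_pauliGroup, Matrix.one_mulVec s⟩

theorem fixingFinset_card_pos (s : Bits κ → ℂ) : 0 < (fixingFinset s).card :=
  Finset.card_pos.mpr ⟨1, one_mem_fixingFinset s⟩

/-- The normalized sum over the group fixing `s` minus the projector onto `s`. -/
noncomputable def stabilizerDefect (s : Bits κ → ℂ) : Matrix (Bits κ) (Bits κ) ℂ :=
  ((fixingFinset s).card : ℂ)⁻¹ • ∑ M ∈ fixingFinset s, M - (star s ⬝ᵥ s)⁻¹ • ketbra s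

theorem sum_fixing_mul_self {s : Bits κ → ℂ} (hs : s ≠ 0) :
    (∑ M ∈ fixingFinset s, M) * ∑ M ∈ fixingFinset s, M =
      ((fixingFinset s).card : ℂ) • ∑ M ∈ fixingFinset s, M := by
  rw [Finset.sum_mul, Nat.cast_smul_eq_nsmul, ← Finset.sum_const]
  refine Finset.sum_congr rfl fun g hg => ?_
  obtain ⟨hg1, -⟩ := mul_self_and_isHermitian_of_fix (mem_fixingFinset.mp hg).1 hs
    (mem_fixingFinset.mp hg).2
  rw [Finset.mul_sum]
  refine Finset.sum_bij' (fun M _ => g * M) (fun M _ => g * M)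
    (fun M hM => mul_mem_fixingFinset hg hM) (fun M hM => mul_mem_fixingFinset hg hM) ?_ ?_ ?_
  · intro M _; rw [← mul_assoc, hg1, one_mul]
  · intro M _; rw [← mul_assoc, hg1, one_mul]
  · intro M _; rfl

theorem sum_fixing_conjTranspose {s : Bits κ → ℂ} (hs : s ≠ 0) :
    (∑ M ∈ fixingFinset s, M)ᴴ = ∑ M ∈ fixingFinset s, M := by
  rw [Matrix.conjTranspose_sum]
  exact Finset.sum_congr rfl fun M hM => (mul_self_and_isHermitian_of_fix
    (mem_fixingFinset.mp hM).1 hs (mem_fixingFinset.mp hM).2).2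

theorem sum_fixing_trace {s : Bits κ → ℂ} (hs : s ≠ 0) :
    (∑ M ∈ fixingFinset s, M).trace = 2 ^ Fintype.card κ := by
  rw [Matrix.trace_sum, Finset.sum_eq_single_of_mem 1 (one_mem_fixingFinset s)
    fun M hM h1 => trace_eq_zero_of_fix (mem_fixingFinset.mp hM).1 hs (mem_fixingFinset.mp hM).2 h1]
  simp [Matrix.trace_one]

omit [Fintype κ] [DecidableEq κ] in
theorem ketbra_conjTranspose (s : Bits κ → ℂ) : (ketbra s)ᴴ = ketbra s := by
  rw [ketbra, Matrix.conjTranspose_vecMulVec, star_star]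

theorem sum_fixing_mul_ketbra (s : Bits κ → ℂ) :
    (∑ M ∈ fixingFinset s, M) * ketbra s = ((fixingFinset s).card : ℂ) • ketbra s := by
  rw [Finset.sum_mul, Nat.cast_smul_eq_nsmul, ← Finset.sum_const]
  refine Finset.sum_congr rfl fun g hg => ?_
  rw [ketbra, Matrix.mul_vecMulVec, (mem_fixingFinset.mp hg).2]

theorem ketbra_mul_sum_fixing {s : Bits κ → ℂ} (hs : s ≠ 0) :
    ketbra s * ∑ M ∈ fixingFinset s, M = ((fixingFinset s).card : ℂ) • ketbra s := by
  have h := congrArg Matrix.conjTranspose (sum_fixing_mul_ketbra s)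
  rw [Matrix.conjTranspose_mul, sum_fixing_conjTranspose hs, ketbra_conjTranspose,
    Matrix.conjTranspose_smul, ketbra_conjTranspose] at h
  simpa using h

theorem ketbra_mul_self (s : Bits κ → ℂ) : ketbra s * ketbra s = (star s ⬝ᵥ s) • ketbra s := by
  rw [ketbra, Matrix.vecMulVec_mul_vecMulVec]
  ext; simp [Matrix.vecMulVec_apply]; ring

/-- The group average is a projector whose range contains `s`, so removing the projector onto `s`
leaves a projector. -/
theorem stabilizerDefect_mul_self {s : Bits κ → ℂ} (hs : s ≠ 0) :
    stabilizerDefect s * stabilizerDefect s = stabilizerDefect s := by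
  have hN : ((fixingFinset s).card : ℂ) ≠ 0 := by
    exact_mod_cast (fixingFinset_card_pos s).ne'
  have hc := star_dotProduct_self_ne_zero hs
  simp only [stabilizerDefect, sub_mul, mul_sub, smul_mul_smul_comm, sum_fixing_mul_self hs,
    sum_fixing_mul_ketbra, ketbra_mul_sum_fixing hs, ketbra_mul_self, smul_smul]
  field_simp
  abel

theorem stabilizerDefect_conjTranspose {s : Bits κ → ℂ} (hs : s ≠ 0) :
    (stabilizerDefect s)ᴴ = stabilizerDefect s := by
  rw [stabilizerDefect, Matrix.conjTranspose_sub, Matrix.conjTranspose_smul,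
    Matrix.conjTranspose_smul, sum_fixing_conjTranspose hs, ketbra_conjTranspose,
    ← norm_sq_eq_dotProduct]
  simp

theorem stabilizerDefect_trace {s : Bits κ → ℂ} (hs : s ≠ 0) :
    (stabilizerDefect s).trace = ((fixingFinset s).card : ℂ)⁻¹ * 2 ^ Fintype.card κ - 1 := by
  have hc := star_dotProduct_self_ne_zero hs
  rw [stabilizerDefect, Matrix.trace_sub, Matrix.trace_smul, Matrix.trace_smul,
    sum_fixing_trace hs, ketbra, Matrix.trace_vecMulVec, dotProduct_comm s, smul_eq_mul, smul_eq_mul,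
    inv_mul_cancel₀ hc]

-- The defect is an orthogonal projector, so its trace `2 ^ m / card - 1`, with `m` the number of
-- qubits, is nonnegative. Equality makes the defect vanish, which gives
-- `IsStabilizerVector.ketbra_eq`.
open scoped ComplexOrder in
theorem fixingFinset_card_le {s : Bits κ → ℂ} (hs : s ≠ 0) :
    (fixingFinset s).card ≤ 2 ^ Fintype.card κ := by
  have h := (Matrix.posSemidef_conjTranspose_mul_self (stabilizerDefect s)).trace_nonneg
  rw [stabilizerDefect_conjTranspose hs, stabilizerDefect_mul_self hs,
    stabilizerDefect_trace hs] at h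
  have h2 : (0 : ℝ) ≤ ((fixingFinset s).card : ℝ)⁻¹ * 2 ^ Fintype.card κ - 1 := by
    rw [← Complex.zero_le_real]
    push_cast
    exact h
  have hN : (0 : ℝ) < (fixingFinset s).card := by exact_mod_cast fixingFinset_card_pos s
  rw [sub_nonneg, inv_mul_eq_div, one_le_div hN] at h2
  exact_mod_cast h2

open scoped ComplexOrder in
/-- A stabilizer vector spans the joint eigenspace of the Pauli operators fixing it. -/
theorem IsStabilizerVector.ketbra_eq {s : Bits κ → ℂ} (hs : IsStabilizerVector s) :
    (star s ⬝ᵥ s)⁻¹ • ketbra s =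
      ((fixingFinset s).card : ℂ)⁻¹ • ∑ M ∈ fixingFinset s, M := by
  have h : (stabilizerDefect s)ᴴ * stabilizerDefect s = 0 := by
    rw [stabilizerDefect_conjTranspose hs.1, stabilizerDefect_mul_self hs.1]
    rw [← Matrix.trace_conjTranspose_mul_self_eq_zero_iff, stabilizerDefect_conjTranspose hs.1,
      stabilizerDefect_mul_self hs.1, stabilizerDefect_trace hs.1, hs.2]
    simp
  rw [stabilizerDefect_conjTranspose hs.1, stabilizerDefect_mul_self hs.1] at h
  exact (sub_eq_zero.mp h).symm

/-- By the upper bound on the group order, exhibiting enough fixing operators suffices; no exact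
count is needed. -/
theorem isStabilizerVector_of_le_card {s : Bits κ → ℂ} (hs : s ≠ 0)
    {F : Finset (Matrix (Bits κ) (Bits κ) ℂ)} (hF : F ⊆ fixingFinset s)
    (h : 2 ^ Fintype.card κ ≤ F.card) : IsStabilizerVector s :=
  ⟨hs, le_antisymm (fixingFinset_card_le hs) (h.trans (Finset.card_le_card hF))⟩

theorem star_dotProduct_mulVec {M : Matrix (Bits κ) (Bits κ) ℂ} (hM : Mᴴ = M)
    (s t : Bits κ → ℂ) : star s ⬝ᵥ (M *ᵥ t) = star (M *ᵥ s) ⬝ᵥ t := by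
  rw [Matrix.dotProduct_mulVec, Matrix.star_mulVec, hM]

/-- Measuring a Pauli observable `M` on a stabilizer state: either the state is an eigenvector, or
both outcomes are equally likely and the state afterwards is a stabilizer state. -/
theorem IsStabilizerVector.measure {s : Bits κ → ℂ} (hs : IsStabilizerVector s)
    {M : Matrix (Bits κ) (Bits κ) ℂ} (hM : M ∈ pauliGroup κ) (hM2 : M * M = 1) :
    M *ᵥ s = s ∨ M *ᵥ s = -s ∨
      (star s ⬝ᵥ (M *ᵥ s) = 0 ∧ IsStabilizerVector (s + M *ᵥ s)) := by
  classical
  have hMH : Mᴴ = M := by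
    calc Mᴴ = Mᴴ * (M * M) := by rw [hM2, mul_one]
      _ = M := by rw [← mul_assoc, conjTranspose_mul_self_of_mem hM, one_mul]
  have hc := star_dotProduct_self_ne_zero hs.1
  have hMM : ∀ t : Bits κ → ℂ, M *ᵥ (M *ᵥ t) = t := fun t => by
    rw [Matrix.mulVec_mulVec, hM2, Matrix.one_mulVec]
  by_cases hcomm : ∀ g ∈ fixingFinset s, M * g = g * M
  -- If `M` commutes with the whole group, it commutes with the projector onto `s`; hence `s` is an
  -- eigenvector, with eigenvalue `±1` as `M * M = 1`.
  · have hK : M * ketbra s = ketbra s * M := by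
      have h1 : M * ((star s ⬝ᵥ s)⁻¹ • ketbra s) = ((star s ⬝ᵥ s)⁻¹ • ketbra s) * M := by
        rw [hs.ketbra_eq, Matrix.mul_smul, Matrix.smul_mul, Finset.mul_sum, Finset.sum_mul,
          Finset.sum_congr rfl hcomm]
      rw [Matrix.mul_smul, Matrix.smul_mul] at h1
      exact smul_right_injective _ (inv_ne_zero hc) h1
    have h2 : (star s ⬝ᵥ s) • (M *ᵥ s) = (star s ⬝ᵥ (M *ᵥ s)) • s := by
      have h3 := congrArg (fun A => A *ᵥ s) hK
      simp only [← Matrix.mulVec_mulVec, ketbra, Matrix.vecMulVec_mulVec, Matrix.mulVec_smul] at h3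
      simpa using h3
    obtain ⟨l, hl⟩ : ∃ l : ℂ, M *ᵥ s = l • s :=
      ⟨(star s ⬝ᵥ s)⁻¹ * (star s ⬝ᵥ (M *ᵥ s)), by
        rw [mul_smul, ← h2, smul_smul, inv_mul_cancel₀ hc, one_smul]⟩
    have h4 := hMM s
    rw [hl, Matrix.mulVec_smul, hl, smul_smul] at h4
    have h5 : (l * l - 1) • s = 0 := by rw [sub_smul, h4, one_smul, sub_self]
    have h6 := (smul_eq_zero.mp h5).resolve_right hs.1
    rcases mul_self_eq_one_iff.mp (sub_eq_zero.mp h6) with rfl | rfl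
    · left; rw [hl, one_smul]
    · right; left; rw [hl, neg_one_smul]
  · push Not at hcomm
    obtain ⟨h, hh, hne⟩ := hcomm
    have hhp := mem_fixingFinset.mp hh
    obtain ⟨hhsq, hhH⟩ := mul_self_and_isHermitian_of_fix hhp.1 hs.1 hhp.2
    have hanti := (pauliGroup_comm_or_anticomm hM hhp.1).resolve_left hne
    have horth : star s ⬝ᵥ (M *ᵥ s) = 0 := by
      have h1 : star s ⬝ᵥ (M *ᵥ s) = -(star s ⬝ᵥ (M *ᵥ s)) := by
        calc star s ⬝ᵥ (M *ᵥ s) = star s ⬝ᵥ ((M * h) *ᵥ s) := by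
              rw [← Matrix.mulVec_mulVec, hhp.2]
          _ = -(star s ⬝ᵥ (h *ᵥ (M *ᵥ s))) := by
              rw [hanti, Matrix.neg_mulVec, dotProduct_neg, Matrix.mulVec_mulVec]
          _ = -(star s ⬝ᵥ (M *ᵥ s)) := by rw [star_dotProduct_mulVec hhH, hhp.2]
      exact self_eq_neg.mp h1
    refine Or.inr (Or.inr ⟨horth, ?_⟩)
    have hMs : M *ᵥ s ≠ s := fun h1 => hc (by rwa [h1] at horth)
    have hw : s + M *ᵥ s ≠ 0 := by
      intro h1
      have h2 : star s ⬝ᵥ (s + M *ᵥ s) = 0 := by rw [h1, dotProduct_zero]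
      rw [dotProduct_add, horth, add_zero] at h2
      exact hc h2
    set C := (fixingFinset s).filter fun g => M * g = g * M with hC
    set D := (fixingFinset s).filter fun g => ¬ M * g = g * M with hD
    -- Multiplication by the anticommuting `h` sends anticommuting elements to commuting ones, so
    -- `C` is at least half of the group. Adjoining the products `g * M` then restores the full
    -- order.
    have hDC : D.card ≤ C.card := by
      refine Finset.card_le_card_of_injOn (fun g => h * g) ?_ ?_
      · intro g hg
        rw [Finset.mem_coe, hD, Finset.mem_filter] at hg
        have h1 := (pauliGroup_comm_or_anticomm hM (mem_fixingFinset.mp hg.1).1).resolve_left hg.2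
        rw [Finset.mem_coe, hC, Finset.mem_filter]
        refine ⟨mul_mem_fixingFinset hh hg.1, ?_⟩
        rw [← mul_assoc, hanti, neg_mul, mul_assoc, h1, mul_neg, neg_neg, mul_assoc]
      · intro g _ g' _ hgg
        have h1 := congrArg (fun A => h * A) hgg
        simpa only [← mul_assoc, hhsq, one_mul] using h1
    have hCD : C.card + D.card = 2 ^ Fintype.card κ := by
      rw [← hs.2]; exact Finset.card_filter_add_card_filter_not _
    have hinj : Function.Injective fun g : Matrix (Bits κ) (Bits κ) ℂ => g * M := by
      intro g g' hgg
      have h1 := congrArg (fun A => A * M) hgg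
      simpa only [mul_assoc, hM2, mul_one] using h1
    have hdisj : Disjoint C (C.image fun g => g * M) := by
      rw [Finset.disjoint_left]
      intro g hg hg'
      obtain ⟨g', hg'', rfl⟩ := Finset.mem_image.mp hg'
      rw [hC, Finset.mem_filter, mem_fixingFinset] at hg hg''
      have h1 := hg.1.2
      rw [← hg''.2, ← Matrix.mulVec_mulVec, hg''.1.2] at h1
      exact hMs h1
    refine isStabilizerVector_of_le_card hw (F := C ∪ C.image fun g => g * M) ?_ ?_
    · intro g hg
      have hfix : ∀ g ∈ C, g *ᵥ (s + M *ᵥ s) = s + M *ᵥ s := by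
        intro g hg
        rw [hC, Finset.mem_filter, mem_fixingFinset] at hg
        rw [Matrix.mulVec_add, Matrix.mulVec_mulVec, ← hg.2, ← Matrix.mulVec_mulVec, hg.1.2]
      rw [mem_fixingFinset]
      rcases Finset.mem_union.mp hg with hg | hg
      · exact ⟨(mem_fixingFinset.mp (Finset.mem_filter.mp hg).1).1, hfix g hg⟩
      · obtain ⟨g', hg', rfl⟩ := Finset.mem_image.mp hg
        refine ⟨mul_mem_pauliGroup (mem_fixingFinset.mp (Finset.mem_filter.mp hg').1).1 hM, ?_⟩
        rw [← Matrix.mulVec_mulVec, Matrix.mulVec_add, hMM, add_comm (M *ᵥ s) s, hfix g' hg']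
    · rw [Finset.card_union_of_disjoint hdisj, Finset.card_image_of_injective _ hinj]
      omega

/-- Pauli operators map stabilizer states to stabilizer states. -/
theorem IsStabilizerVector.mulVec {s : Bits κ → ℂ} (hs : IsStabilizerVector s)
    {M : Matrix (Bits κ) (Bits κ) ℂ} (hM : M ∈ pauliGroup κ) (hM2 : M * M = 1) :
    IsStabilizerVector (M *ᵥ s) := by
  classical
  have hMM : ∀ t : Bits κ → ℂ, M *ᵥ (M *ᵥ t) = t := fun t => by
    rw [Matrix.mulVec_mulVec, hM2, Matrix.one_mulVec]
  have hw : M *ᵥ s ≠ 0 := fun h => hs.1 (by rw [← hMM s, h, Matrix.mulVec_zero])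
  -- Conjugation by the involution `M` transports the group of `s` to that of `M *ᵥ s`.
  refine isStabilizerVector_of_le_card hw (F := (fixingFinset s).image fun g => M * g * M) ?_ ?_
  · intro g hg
    obtain ⟨g', hg', rfl⟩ := Finset.mem_image.mp hg
    rw [mem_fixingFinset] at *
    refine ⟨mul_mem_pauliGroup (mul_mem_pauliGroup hM hg'.1) hM, ?_⟩
    rw [← Matrix.mulVec_mulVec, hMM, ← Matrix.mulVec_mulVec, hg'.2]
  · rw [Finset.card_image_of_injective, hs.2]
    intro g g' hgg
    have h1 := congrArg (fun A => M * A * M) hgg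
    simpa only [mul_assoc, hM2, mul_one, ← mul_assoc M M, one_mul] using h1

end StabilizerStates

/-! ### Restricting stabilizer states to prescribed bit values. -/

section Restriction

/-- The eigenvalue of `Z` on the computational basis state labelled by a bit. -/
def bitSign (b : Fin 2) : ℂ := (-1) ^ (b : ℕ)

theorem bitSign_mul_eq_one_iff (a b : Fin 2) : bitSign a * bitSign b = 1 ↔ a = b := by
  fin_cases a <;> fin_cases b <;> simp [bitSign] <;> norm_num

theorem bitSign_eq (a : Fin 2) : bitSign a = 1 ∨ bitSign a = -1 := by
  fin_cases a <;> simp [bitSign]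

theorem bitSign_mul_of_ne {a b : Fin 2} (h : a ≠ b) : bitSign a * bitSign b = -1 := by
  fin_cases a <;> fin_cases b <;> simp_all [bitSign]

theorem mul_eq_one_or_neg_one {a b : ℂ} (ha : a = 1 ∨ a = -1) (hb : b = 1 ∨ b = -1) :
    a * b = 1 ∨ a * b = -1 := by
  rcases ha with rfl | rfl <;> rcases hb with rfl | rfl <;> simp

variable {κ : Type} [Fintype κ] [DecidableEq κ]

theorem diagonal_bitSign_mem (i : κ) :
    Matrix.diagonal (fun y : Bits κ => bitSign (y i)) ∈ pauliGroup κ := by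
  have h : Matrix.diagonal (fun y : Bits κ => bitSign (y i)) =
      pauliString fun j => if j = i then 3 else 0 := by
    have hp : ∀ j (a b : Fin 2), pauli (if j = i then 3 else 0) a b =
        if a = b then (if j = i then bitSign a else 1) else 0 := by
      intro j a b
      by_cases hj : j = i <;> fin_cases a <;> fin_cases b <;> simp [hj, pauli, bitSign]
    ext x y
    simp only [pauliString, Matrix.of_apply, hp, Finset.prod_ite_zero, Matrix.diagonal_apply,
      Finset.mem_univ, forall_const, funext_iff, Finset.prod_ite_eq', if_true]
  rw [h]
  exact pauliString_mem _

theorem diagonal_mul_mem {f g : Bits κ → ℂ} (hf : Matrix.diagonal f ∈ pauliGroup κ)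
    (hg : Matrix.diagonal g ∈ pauliGroup κ) :
    Matrix.diagonal (fun y => f y * g y) ∈ pauliGroup κ := by
  rw [← Matrix.diagonal_mul_diagonal]
  exact mul_mem_pauliGroup hf hg

theorem diagonal_const_mem {c : ℂ} (hc : c = 1 ∨ c = -1) :
    Matrix.diagonal (fun _ : Bits κ => c) ∈ pauliGroup κ := by
  rcases hc with rfl | rfl
  · exact Matrix.diagonal_one (n := Bits κ) (α := ℂ) ▸ one_mem_pauliGroup
  · have h := neg_mem_pauliGroup (one_mem_pauliGroup (κ := κ))
    rwa [← Matrix.diagonal_one, Matrix.diagonal_neg] at h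

theorem diagonal_sign_mul_self {f : Bits κ → ℂ} (hf : ∀ y, f y = 1 ∨ f y = -1) :
    Matrix.diagonal f * Matrix.diagonal f = 1 := by
  rw [Matrix.diagonal_mul_diagonal, ← Matrix.diagonal_one]
  congr 1
  funext y
  rcases hf y with h | h <;> simp [h]

/-- The restriction of a stabilizer state to an eigenspace of a diagonal Pauli operator. -/
theorem IsStabilizerVector.indicator_sign {s : Bits κ → ℂ} (hs : IsStabilizerVector s)
    {f : Bits κ → ℂ} (hf : Matrix.diagonal f ∈ pauliGroup κ) (hf1 : ∀ y, f y = 1 ∨ f y = -1) :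
    Set.indicator {y | f y = 1} s = 0 ∨ IsStabilizerVector (Set.indicator {y | f y = 1} s) := by
  -- Restriction is the spectral projector `(1 + M) / 2` of the diagonal Pauli `M`.
  have key : Set.indicator {y | f y = 1} s = (2⁻¹ : ℂ) • (s + Matrix.diagonal f *ᵥ s) := by
    funext y
    rw [Pi.smul_apply, Pi.add_apply, Matrix.mulVec_diagonal]
    simp only [Set.indicator_apply, Set.mem_ofPred_eq]
    rcases hf1 y with h | h
    · rw [if_pos h, h, smul_eq_mul]; ring
    · rw [if_neg (by rw [h]; norm_num), h]; simp
  rw [key]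
  have h2 : (2⁻¹ : ℂ) ≠ 0 := by norm_num
  rcases hs.measure hf (diagonal_sign_mul_self hf1) with h | h | ⟨-, h⟩
  · right
    rw [h, ← two_smul ℂ s, smul_smul, inv_mul_cancel₀ two_ne_zero, one_smul]
    exact hs
  · left; rw [h, add_neg_cancel, smul_zero]
  · exact Or.inr (h.smul h2)

theorem IsStabilizerVector.indicator_forall_sign {s : Bits κ → ℂ} (hs : IsStabilizerVector s)
    {f : κ → Bits κ → ℂ} (hf : ∀ i, Matrix.diagonal (f i) ∈ pauliGroup κ)
    (hf1 : ∀ i y, f i y = 1 ∨ f i y = -1) (T : Finset κ) :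
    Set.indicator {y | ∀ i ∈ T, f i y = 1} s = 0 ∨
      IsStabilizerVector (Set.indicator {y | ∀ i ∈ T, f i y = 1} s) := by
  induction T using Finset.induction_on with
  | empty => right; simpa using hs
  | insert i T _ ih =>
    have hset : {y | ∀ j ∈ insert i T, f j y = 1} = {y | f i y = 1} ∩ {y | ∀ j ∈ T, f j y = 1} := by
      ext y; simp
    rw [hset, ← Set.indicator_indicator]
    rcases ih with h | h
    · left; rw [h, Set.indicator_zero']
    · exact h.indicator_sign (hf i) (hf1 i)

/-- Restricting a stabilizer state to two values of the bits in `T`. -/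
theorem IsStabilizerVector.indicator_pair {s : Bits κ → ℂ} (hs : IsStabilizerVector s)
    {T : Finset κ} {x e : Bits κ} {j : κ} (hj : j ∈ T) (hxe : x j ≠ e j) :
    Set.indicator {y | (∀ i ∈ T, y i = x i) ∨ ∀ i ∈ T, y i = e i} s = 0 ∨
      IsStabilizerVector
        (Set.indicator {y | (∀ i ∈ T, y i = x i) ∨ ∀ i ∈ T, y i = e i} s) := by
  -- Where `x` and `e` agree, `±Z_i` pins the bit. Where they differ, `±Z_i Z_j` ties bit `i` to the
  -- reference bit `j`, so these bits follow `e` all together or `x` all together.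
  let f : κ → Bits κ → ℂ := fun i y => if x i = e i then bitSign (e i) * bitSign (y i) else
    bitSign (e i) * bitSign (e j) * (bitSign (y i) * bitSign (y j))
  have hf : ∀ i, Matrix.diagonal (f i) ∈ pauliGroup κ := by
    intro i
    by_cases h : x i = e i
    · simp only [f, if_pos h]
      exact diagonal_mul_mem (diagonal_const_mem (bitSign_eq _)) (diagonal_bitSign_mem i)
    · simp only [f, if_neg h]
      exact diagonal_mul_mem (diagonal_const_mem
        (mul_eq_one_or_neg_one (bitSign_eq _) (bitSign_eq _)))
        (diagonal_mul_mem (diagonal_bitSign_mem i) (diagonal_bitSign_mem j))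
  have hf1 : ∀ i y, f i y = 1 ∨ f i y = -1 := by
    intro i y
    simp only [f]
    split_ifs
    · exact mul_eq_one_or_neg_one (bitSign_eq _) (bitSign_eq _)
    · exact mul_eq_one_or_neg_one (mul_eq_one_or_neg_one (bitSign_eq _) (bitSign_eq _))
        (mul_eq_one_or_neg_one (bitSign_eq _) (bitSign_eq _))
  have hfix : ∀ i y, f i y = 1 ↔ if x i = e i then y i = e i else (y i = e i ↔ y j = e j) := by
    intro i y
    simp only [f]
    split_ifs with h
    · rw [bitSign_mul_eq_one_iff, eq_comm]
    · generalize y i = a, y j = b, e i = c, e j = d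
      fin_cases a <;> fin_cases b <;> fin_cases c <;> fin_cases d <;> simp [bitSign] <;> norm_num
  have hset : {y | (∀ i ∈ T, y i = x i) ∨ ∀ i ∈ T, y i = e i} = {y | ∀ i ∈ T, f i y = 1} := by
    have hbit : ∀ a b c : Fin 2, b ≠ c → (a = b ↔ a ≠ c) := by decide
    ext y
    simp only [Set.mem_ofPred_eq, hfix]
    constructor
    · rintro (h | h) i hi
      · rw [h i hi, h j hj]
        split_ifs with h1
        · exact h1
        · simp [h1, hxe]
      · rw [h i hi, h j hj]
        simp
    · intro h
      by_cases hyj : y j = e j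
      · refine Or.inr fun i hi => ?_
        have := h i hi
        split_ifs at this with h1
        · exact this
        · exact this.mpr hyj
      · refine Or.inl fun i hi => ?_
        have := h i hi
        split_ifs at this with h1
        · rw [this, h1]
        · exact (hbit _ _ _ h1).mpr fun h2 => hyj (this.mp h2)
  rw [hset]
  exact hs.indicator_forall_sign hf hf1 T

/-- The part of `s` in which the bits in `T` are those of `x`. -/
noncomputable def component (T : Finset κ) (s : Bits κ → ℂ) (x : Bits κ) : Bits κ → ℂ :=
  Set.indicator {y | ∀ i ∈ T, y i = x i} s

omit [Fintype κ] [DecidableEq κ] in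
theorem component_add_component {T : Finset κ} {x e : Bits κ} {j : κ} (hj : j ∈ T)
    (hxe : x j ≠ e j) (s : Bits κ → ℂ) : component T s x + component T s e =
      Set.indicator {y | (∀ i ∈ T, y i = x i) ∨ ∀ i ∈ T, y i = e i} s := by
  refine (Set.indicator_union_of_disjoint ?_ s).symm
  rw [Set.disjoint_left]
  intro y hy hy'
  exact hxe ((hy j hj).symm.trans (hy' j hj))

theorem star_component_dotProduct {T : Finset κ} {x e : Bits κ} {j : κ} (hj : j ∈ T)
    (hxe : x j ≠ e j) (s : Bits κ → ℂ) : star (component T s x) ⬝ᵥ component T s e = 0 := by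
  refine Finset.sum_eq_zero fun y _ => ?_
  simp only [component, Pi.star_apply, Set.indicator_apply, Set.mem_ofPred_eq]
  split_ifs with h1 h2
  · exact absurd ((h1 j hj).symm.trans (h2 j hj)) hxe
  · simp
  · simp
  · simp

/-- Two nonzero components of a stabilizer state have the same norm, and their sum and difference
are proportional to stabilizer states. -/
theorem IsStabilizerVector.component_pair {s : Bits κ → ℂ} (hs : IsStabilizerVector s)
    {T : Finset κ} {x e : Bits κ} {j : κ} (hj : j ∈ T) (hxe : x j ≠ e j)
    (hx : component T s x ≠ 0) (he : component T s e ≠ 0) :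
    IsStabilizerVector (component T s x + component T s e) ∧
      IsStabilizerVector (component T s x - component T s e) ∧
      star (component T s x) ⬝ᵥ component T s x = star (component T s e) ⬝ᵥ component T s e := by
  classical
  set u := component T s x with hu
  set v := component T s e with hv
  have huv : star u ⬝ᵥ v = 0 := star_component_dotProduct hj hxe s
  have hvu : star v ⬝ᵥ u = 0 := star_component_dotProduct hj hxe.symm s
  have hw : IsStabilizerVector (u + v) := by
    have h := hs.indicator_pair hj hxe
    rw [← component_add_component hj hxe, ← hu, ← hv] at h
    refine h.resolve_left fun h0 => hx ?_
    have h1 : star u ⬝ᵥ (u + v) = 0 := by rw [h0, dotProduct_zero]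
    rw [dotProduct_add, huv, add_zero] at h1
    by_contra hne
    exact star_dotProduct_self_ne_zero hne h1
  have hf1 : ∀ y : Bits κ, bitSign (x j) * bitSign (y j) = 1 ∨
      bitSign (x j) * bitSign (y j) = -1 := fun y =>
    mul_eq_one_or_neg_one (bitSign_eq _) (bitSign_eq _)
  have hM := diagonal_mul_mem (diagonal_const_mem (κ := κ) (bitSign_eq (x j)))
    (diagonal_bitSign_mem j)
  have hM2 := diagonal_sign_mul_self hf1
  have hact : Matrix.diagonal (fun y : Bits κ => bitSign (x j) * bitSign (y j)) *ᵥ (u + v) =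
      u - v := by
    funext y
    rw [Matrix.mulVec_diagonal, Pi.add_apply, Pi.sub_apply, hu, hv]
    simp only [component, Set.indicator_apply, Set.mem_ofPred_eq]
    split_ifs with h1 h2 h2
    · exact absurd ((h1 j hj).symm.trans (h2 j hj)) hxe
    · rw [h1 j hj, (bitSign_mul_eq_one_iff _ _).mpr rfl]; ring
    · rw [h2 j hj, bitSign_mul_of_ne hxe]; ring
    · simp
  refine ⟨hw, hact ▸ hw.mulVec hM hM2, ?_⟩
  -- The operator `±Z_j` maps `u + v` to `u - v`. An eigenvector would force `v = 0` or `u = 0`;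
  -- otherwise `u + v` is orthogonal to `u - v`, which equates the norms.
  rcases hw.measure hM hM2 with h | h | ⟨h, -⟩
  · rw [hact] at h
    refine absurd ?_ he
    have h1 : (2 : ℂ) • v = 0 := by rw [two_smul]; linear_combination (exp := 1) -h
    exact (smul_eq_zero.mp h1).resolve_left two_ne_zero
  · rw [hact] at h
    refine absurd ?_ hx
    have h1 : (2 : ℂ) • u = 0 := by rw [two_smul]; linear_combination (exp := 1) h
    exact (smul_eq_zero.mp h1).resolve_left two_ne_zero
  · rw [hact, star_add, add_dotProduct, dotProduct_sub, dotProduct_sub, huv, hvu] at h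
    linear_combination h

end Restriction

/-! ### Robustness bounds from signed sums of stabilizer states. -/

section Robustness

variable {κ : Type} [Fintype κ] [DecidableEq κ]

theorem IsStabilizerVector.inv_smul_ketbra_mem {s : Bits κ → ℂ} (hs : IsStabilizerVector s) {r : ℝ}
    (hr : star s ⬝ᵥ s = r) : r⁻¹ • ketbra s ∈ STAB κ := by
  have hr2 : r = ∑ x, ‖s x‖ ^ 2 := by
    rw [← norm_sq_eq_dotProduct] at hr
    exact_mod_cast hr.symm
  have hr0 : 0 < r := by
    refine lt_of_le_of_ne (hr2 ▸ Finset.sum_nonneg fun x _ => by positivity) fun h => ?_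
    exact star_dotProduct_self_ne_zero hs.1 (by rw [hr, ← h, Complex.ofReal_zero])
  have hsq : (√r)⁻¹ * (√r)⁻¹ = r⁻¹ := by rw [← mul_inv, Real.mul_self_sqrt hr0.le]
  refine subset_convexHull ℝ _ ⟨((√r)⁻¹ : ℂ) • s, ?_, ?_⟩
  · rw [isPureStabilizer_iff]
    refine ⟨?_, hs.smul (by simpa using (Real.sqrt_pos.mpr hr0).ne')⟩
    simp only [Pi.smul_apply, norm_smul, mul_pow, ← Finset.mul_sum, ← hr2]
    rw [norm_inv, Complex.norm_real, Real.norm_of_nonneg (Real.sqrt_nonneg r), inv_pow,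
      Real.sq_sqrt hr0.le, inv_mul_cancel₀ hr0.ne']
  · ext x y
    simp only [ketbra, Matrix.smul_apply, Matrix.vecMulVec_apply, Pi.star_apply, Pi.smul_apply,
      smul_eq_mul, star_mul', Complex.real_smul, ← hsq]
    simp
    ring

theorem IsPureStabilizer.ketbra_mem {s : Bits κ → ℂ} (hs : IsPureStabilizer s) :
    ketbra s ∈ STAB κ :=
  subset_convexHull ℝ _ ⟨s, hs, rfl⟩

theorem robustness_le {ρ σ τ : Matrix (Bits κ) (Bits κ) ℂ} {a : ℝ} (ha : 0 ≤ a)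
    (hσ : σ ∈ STAB κ) (hτ : τ ∈ STAB κ) (h : ρ = (a + 1) • σ - a • τ) :
    robustness ρ ≤ ENNReal.ofReal (2 * a + 1) :=
  sInf_le ⟨a, σ, τ, ha, hσ, hτ, h, rfl⟩

theorem robustness_le_one {ρ : Matrix (Bits κ) (Bits κ) ℂ} (h : ρ ∈ STAB κ) :
    robustness ρ ≤ 1 := by
  have h1 := robustness_le (ρ := ρ) (a := 0) le_rfl h h (by simp)
  simpa using h1

theorem robustness_le_of_eq_add_sum {α : Type*} {ρ σ : Matrix (Bits κ) (Bits κ) ℂ}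
    (hσ : σ ∈ STAB κ) {c : ℝ} (hc : 0 < c) (S : Finset α)
    (A B : α → Matrix (Bits κ) (Bits κ) ℂ) (hA : ∀ x ∈ S, A x ∈ STAB κ)
    (hB : ∀ x ∈ S, B x ∈ STAB κ) (h : ρ = σ + c • ∑ x ∈ S, (A x - B x)) :
    robustness ρ ≤ ENNReal.ofReal (2 * (c * S.card) + 1) := by
  rcases S.eq_empty_or_nonempty with rfl | hS
  · have h1 : ρ = σ := by simpa using h
    simpa [h1] using robustness_le_one hσ
  have hK : (0 : ℝ) < S.card := by exact_mod_cast hS.card_pos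
  have hconv : Convex ℝ (STAB κ) := convex_convexHull ℝ _
  have hmean : ∀ D : α → Matrix (Bits κ) (Bits κ) ℂ, (∀ x ∈ S, D x ∈ STAB κ) →
      (S.card : ℝ)⁻¹ • ∑ x ∈ S, D x ∈ STAB κ := by
    intro D hD
    rw [Finset.smul_sum]
    refine hconv.sum_mem (fun _ _ => by positivity) ?_ hD
    rw [Finset.sum_const, nsmul_eq_mul, mul_inv_cancel₀ hK.ne']
  have ha : 0 < c * S.card := by positivity
  -- With `a = c * S.card`, the positive part is the mixture of `σ` and the mean of the `A x` with
  -- weights `1 / (a + 1)` and `a / (a + 1)`; the negative part is the mean of the `B x`.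
  refine robustness_le ha.le (hconv hσ (hmean A hA) (a := (c * S.card + 1)⁻¹)
    (b := (c * S.card + 1)⁻¹ * (c * S.card)) (by positivity) (by positivity) ?_) (hmean B hB) ?_
  · field_simp
    ring
  · rw [h, smul_add, smul_smul, smul_smul, smul_smul, smul_smul, ← mul_assoc,
      mul_inv_cancel₀ (by positivity : c * (S.card : ℝ) + 1 ≠ 0), one_smul, one_mul,
      mul_assoc c, mul_inv_cancel₀ hK.ne', mul_one, Finset.sum_sub_distrib, smul_sub, add_sub_assoc]

omit [Fintype κ] [DecidableEq κ] in
theorem ketbra_sum_sub {α : Type*} (S : Finset α) (u : α → Bits κ → ℂ) (v : Bits κ → ℂ) :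
    ketbra (∑ x ∈ S, u x - v) =
      ketbra (∑ x ∈ S, u x + v) + ∑ x ∈ S, (ketbra (u x - v) - ketbra (u x + v)) := by
  have h : ∀ a : Bits κ → ℂ, ketbra (a - v) - ketbra (a + v) =
      (-2 : ℂ) • (Matrix.vecMulVec a (star v) + Matrix.vecMulVec v (star a)) := by
    intro a
    ext x y
    simp [ketbra, Matrix.vecMulVec_apply]
    ring
  have hsum : ∑ x ∈ S, (Matrix.vecMulVec (u x) (star v) + Matrix.vecMulVec v (star (u x))) =
      Matrix.vecMulVec (∑ x ∈ S, u x) (star v) + Matrix.vecMulVec v (star (∑ x ∈ S, u x)) := by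
    ext x y
    simp [Matrix.sum_apply, Matrix.vecMulVec_apply, Finset.sum_add_distrib, Finset.sum_mul,
      Finset.mul_sum, Finset.sum_apply]
  rw [← sub_eq_iff_eq_add', h, Finset.sum_congr rfl fun x _ => h (u x), ← Finset.smul_sum, hsum]

end Robustness

/-! ### Reflections about a basis state and their magic capacity. -/

section MagicCapacity

variable {ι : Type} [Fintype ι] [DecidableEq ι]

/-- The part of a state of two registers in which the first register is in the basis state `x`. -/
noncomputable def registerComponent (s : Bits (ι ⊕ ι) → ℂ) (x : Bits ι) : Bits (ι ⊕ ι) → ℂ :=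
  component (Finset.univ.map Function.Embedding.inl) s (Sum.elim x x)

omit [DecidableEq ι] in
theorem registerComponent_apply (s : Bits (ι ⊕ ι) → ℂ) (x : Bits ι) (y : Bits (ι ⊕ ι)) :
    registerComponent s x y = if x = fun i => y (Sum.inl i) then s y else 0 := by
  classical
  simp [registerComponent, component, Set.indicator_apply, funext_iff, eq_comm]

theorem sum_registerComponent (s : Bits (ι ⊕ ι) → ℂ) : ∑ x, registerComponent s x = s := by
  funext y
  simp [Finset.sum_apply, registerComponent_apply]

theorem sum_dotProduct_registerComponent (s : Bits (ι ⊕ ι) → ℂ) :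
    ∑ x, star (registerComponent s x) ⬝ᵥ registerComponent s x = star s ⬝ᵥ s := by
  simp only [dotProduct]
  rw [Finset.sum_comm]
  refine Finset.sum_congr rfl fun y _ => ?_
  simp [registerComponent_apply, apply_ite star]

theorem withAncilla_diagonal (d : Bits ι → ℂ) :
    withAncilla (Matrix.diagonal d) = Matrix.diagonal fun y => d fun i => y (Sum.inl i) := by
  rw [withAncilla, ← Matrix.diagonal_one, Matrix.diagonal_kronecker_diagonal,
    Matrix.submatrix_diagonal_equiv]
  congr 1
  funext y
  simp [Equiv.sumArrowEquivProdArrow]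
  rfl

theorem withAncilla_reflection_mulVec (e : Bits ι) (s : Bits (ι ⊕ ι) → ℂ) :
    withAncilla (Matrix.diagonal fun x => if x = e then -1 else 1) *ᵥ s =
      ∑ x ∈ Finset.univ.erase e, registerComponent s x - registerComponent s e := by
  rw [withAncilla_diagonal, Finset.sum_erase_eq_sub (Finset.mem_univ e), sum_registerComponent]
  funext y
  rw [Matrix.mulVec_diagonal, Pi.sub_apply, Pi.sub_apply, registerComponent_apply]
  by_cases h : (fun i => y (Sum.inl i)) = e
  · rw [if_pos h, if_pos h.symm]; ring
  · rw [if_neg h, if_neg (Ne.symm h)]; ring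

theorem IsStabilizerVector.registerComponent_pair {s : Bits (ι ⊕ ι) → ℂ}
    (hs : IsStabilizerVector s) {x e : Bits ι} (hxe : x ≠ e) (hx : registerComponent s x ≠ 0)
    (he : registerComponent s e ≠ 0) :
    IsStabilizerVector (registerComponent s x + registerComponent s e) ∧
      IsStabilizerVector (registerComponent s x - registerComponent s e) ∧
      star (registerComponent s x) ⬝ᵥ registerComponent s x =
        star (registerComponent s e) ⬝ᵥ registerComponent s e ∧
      star (registerComponent s x) ⬝ᵥ registerComponent s e = 0 ∧
      star (registerComponent s e) ⬝ᵥ registerComponent s x = 0 := by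
  obtain ⟨j, hj⟩ := Function.ne_iff.mp hxe
  have hjT : (Sum.inl j : ι ⊕ ι) ∈ Finset.univ.map Function.Embedding.inl := by simp
  have hne : Sum.elim x x (Sum.inl j : ι ⊕ ι) ≠ Sum.elim e e (Sum.inl j : ι ⊕ ι) := hj
  obtain ⟨h1, h2, h3⟩ := hs.component_pair hjT hne hx he
  exact ⟨h1, h2, h3, star_component_dotProduct hjT hne s,
    star_component_dotProduct hjT hne.symm s⟩

/-- The parts of `s` have disjoint supports, so their squared norms add up to 1. -/
theorem mul_card_add_one_eq_one {s : Bits (ι ⊕ ι) → ℂ} (hs : ∑ y, ‖s y‖ ^ 2 = 1) {e : Bits ι}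
    {q : ℝ} (he : star (registerComponent s e) ⬝ᵥ registerComponent s e = q)
    (hx : ∀ x ∈ {x ∈ Finset.univ.erase e | registerComponent s x ≠ 0},
      star (registerComponent s x) ⬝ᵥ registerComponent s x = q) :
    q * (({x ∈ Finset.univ.erase e | registerComponent s x ≠ 0} : Finset (Bits ι)).card + 1)
      = 1 := by
  have h1 := sum_dotProduct_registerComponent s
  rw [← norm_sq_eq_dotProduct s, hs, ← Finset.sum_erase_add _ _ (Finset.mem_univ e), he,
    ← Finset.sum_filter_of_ne (p := fun x => registerComponent s x ≠ 0),
    Finset.sum_congr rfl hx, Finset.sum_const, nsmul_eq_mul] at h1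
  · rw [mul_add_one, mul_comm]
    exact_mod_cast h1
  · intro x _ hx h0
    exact hx (by rw [h0, dotProduct_zero])

/-- The robustness generated by a reflection about a computational basis state. -/
theorem robustness_reflection_le (e : Bits ι) {s : Bits (ι ⊕ ι) → ℂ} (hs : IsPureStabilizer s) :
    robustness (ketbra (withAncilla (Matrix.diagonal fun x => if x = e then -1 else 1) *ᵥ s)) ≤
      ENNReal.ofReal (5 - 4 / Fintype.card (Bits ι)) := by
  classical
  have hcard : (1 : ℝ) ≤ Fintype.card (Bits ι) := by
    exact_mod_cast Fintype.card_pos_iff.mpr ⟨e⟩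
  obtain ⟨hs1, hsv⟩ := (isPureStabilizer_iff s).mp hs
  rw [withAncilla_reflection_mulVec]
  have hsplit : ∑ x ∈ Finset.univ.erase e, registerComponent s x + registerComponent s e = s := by
    rw [Finset.sum_erase_add _ _ (Finset.mem_univ e), sum_registerComponent]
  -- Without an `e` part the reflection fixes `s`, and the robustness is at most 1.
  by_cases he : registerComponent s e = 0
  · rw [he, add_zero] at hsplit
    rw [he, sub_zero, hsplit]
    refine (robustness_le_one hs.ketbra_mem).trans ?_
    rw [ENNReal.one_le_ofReal, le_sub_comm, div_le_iff₀ (by linarith)]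
    linarith
  set S := (Finset.univ.erase e).filter fun x => registerComponent s x ≠ 0 with hS
  have hSsum : ∑ x ∈ Finset.univ.erase e, registerComponent s x =
      ∑ x ∈ S, registerComponent s x := (Finset.sum_filter_ne_zero _).symm
  have hpair : ∀ x ∈ S, _ := fun x hx => hsv.registerComponent_pair
    (Finset.ne_of_mem_erase (Finset.mem_filter.mp hx).1) (Finset.mem_filter.mp hx).2 he
  obtain ⟨q, hq⟩ : ∃ q : ℝ, star (registerComponent s e) ⬝ᵥ registerComponent s e = q :=
    ⟨_, (norm_sq_eq_dotProduct _).symm⟩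
  have hq1 : q * (S.card + 1) = 1 :=
    mul_card_add_one_eq_one hs1 hq fun x hx => (hpair x hx).2.2.1.trans hq
  have hq0 : 0 < q := pos_of_mul_pos_left (hq1 ▸ one_pos) (by positivity)
  have hK : (S.card : ℝ) + 1 ≤ Fintype.card (Bits ι) := by
    have h1 : S.card < Fintype.card (Bits ι) :=
      Finset.card_lt_univ_of_notMem (x := e) (by simp [hS])
    exact_mod_cast h1
  have hnorm : ∀ x ∈ S,
      star (registerComponent s x - registerComponent s e) ⬝ᵥ
        (registerComponent s x - registerComponent s e) = ((2 * q : ℝ) : ℂ) ∧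
      star (registerComponent s x + registerComponent s e) ⬝ᵥ
        (registerComponent s x + registerComponent s e) = ((2 * q : ℝ) : ℂ) := by
    intro x hx
    obtain ⟨-, -, h3, h4, h5⟩ := hpair x hx
    simp only [star_sub, star_add, sub_dotProduct, add_dotProduct, dotProduct_sub, dotProduct_add,
      h3, h4, h5, hq]
    push_cast
    constructor <;> ring
  have hρ := ketbra_sum_sub S (registerComponent s) (registerComponent s e)
  rw [← hSsum, hsplit] at hρ
  -- The factor `2 * q` is the squared norm of each `u x ± v`, by orthogonality of the parts.
  refine (robustness_le_of_eq_add_sum hs.ketbra_mem (c := 2 * q) (by positivity) S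
    (fun x => (2 * q)⁻¹ • ketbra (registerComponent s x - registerComponent s e))
    (fun x => (2 * q)⁻¹ • ketbra (registerComponent s x + registerComponent s e))
    (fun x hx => (hpair x hx).2.1.inv_smul_ketbra_mem (hnorm x hx).1)
    (fun x hx => (hpair x hx).1.inv_smul_ketbra_mem (hnorm x hx).2) ?_).trans ?_
  · simp only [← smul_sub, ← Finset.smul_sum]
    rw [smul_smul, mul_inv_cancel₀ (by positivity), one_smul, hρ]
  · refine ENNReal.ofReal_le_ofReal ?_
    -- By `hq1`, the bound `4 * q * K + 1` equals `5 - 4 * q`, so a lower bound on `q` suffices.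
    have h1 : 1 / (Fintype.card (Bits ι) : ℝ) ≤ q := by
      rw [div_le_iff₀ (by linarith), ← hq1]
      exact mul_le_mul_of_nonneg_left hK hq0.le
    have h2 : 4 / (Fintype.card (Bits ι) : ℝ) = 4 * (1 / Fintype.card (Bits ι)) := by ring
    rw [h2]
    linarith

theorem magicCapacity_reflection_lt (e : Bits ι) :
    magicCapacity (Matrix.diagonal fun x => if x = e then -1 else 1) < 5 := by
  have hcard : (0 : ℝ) < Fintype.card (Bits ι) := by
    exact_mod_cast Fintype.card_pos_iff.mpr ⟨e⟩
  refine lt_of_le_of_lt (b := ENNReal.ofReal (5 - 4 / Fintype.card (Bits ι))) (sSup_le ?_) ?_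
  · rintro r ⟨s, hs, rfl⟩
    exact robustness_reflection_le e hs
  · have h : (0 : ℝ) < 4 / Fintype.card (Bits ι) := by positivity
    rw [← ENNReal.ofReal_ofNat 5]
    exact (ENNReal.ofReal_lt_ofReal_iff (by norm_num)).mpr (by linarith)

end MagicCapacity

theorem mainTheorem5 (n : ℕ) (hn : 1 ≤ n) : magicCapacity (multiControlledZ n) < 5 := by
  have h : multiControlledZ n =
      Matrix.diagonal fun x : Bits (Fin n) => if x = fun _ => 1 then -1 else 1 := by
    simp only [multiControlledZ, funext_iff]
  rw [h]
  exact magicCapacity_reflection_lt _
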